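/- Fix $\beta\ge 0$ and let $\theta=1-\tanh(2\beta)$. For $n\ge 3$ let $\Lambda_n=\mathbb Z/n\mathbb Z$ be the cycle of length $n$, let $$\pi(\sigma)=Z^{-1}\exp\Big(\beta\sum_{uv\in E(\Lambda_n)}\sigma(u)\sigma(v)\Big),\qquad \sigma\in\{\pm1\}^{\Lambda_n},$$ be the Ising measure with no external field, and let $(X_t)$ be the continuous-time heat-bath Glauber dynamics for $\pi$: each site is updated at rate one, and an update at $u$ replaces the spin at $u$ by a sample from $\pi$ conditioned on the other spins. Write $\mathbb P_{x_0}$ for its law started from $X_0=x_0$. For $t\ge 0$ let $P_t(u,u')$ be the transition probability of the continuous-time simple random walk on $\Lambda_n$ with jumps at rate $1-\theta$, and for $x_0\in\{\pm1\}^{\Lambda_n}$ put $$R_t(u,x_0)=\sum_{u'\in\Lambda_n}P_t(u,u')\,x_0(u').$$ For a sequence $(a_n)$ of positive reals with $a_n=n^{o(1)}$ put $t_n=\frac1{2\theta}\log n-\frac1\theta\log\log n-\frac1\theta\log a_n$ (which tends to infinity), and consider, for $x_0\in\{\pm1\}^{\Lambda_n}$, the condition $$\frac1n\sum_{u\in\Lambda_n}|R_{t_n}(u,x_0)|\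 \ge\ \frac1{a_n}.\qquad(*)$$ 1. Let $(a_n)$ be a sequence of positive reals with $a_n=n^{o(1)}$, and let $x_0=x_0^{(n)}\in\{\pm1\}^{\Lambda_n}$ satisfy $(*)$ for all large $n$. Then $$\|\mathbb P_{x_0}(X_{t_n}\in\cdot)-\pi\|_{\mathrm{TV}}=1-o(1)\qquad\text{as } n\to\infty.$$ 2. There is a constant $C=C(\beta)>0$ such that, for $a_n=C\log n$ and $x_0$ uniformly distributed on $\{\pm1\}^{\Lambda_n}$, the condition $(*)$ holds with probability $1-o(1)$ as $n\to\infty$. -/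

import Mathlib

open Filter Topology

noncomputable section

namespace IsingCycle

section Graph

variable {V : Type*} [Fintype V] [DecidableEq V]

/-- The real value `±1` of the spin of the configuration `σ` at the site `u`. -/
def spin (σ : V → ℤˣ) (u : V) : ℝ := ((σ u : ℤ) : ℝ)

/-- The configuration `σ` with the spin at `u` flipped. -/
def flip (σ : V → ℤˣ) (u : V) : V → ℤˣ := Function.update σ u (-σ u)

/-- The product `σ(u) σ(v)` of the spins at the two endpoints of an edge. -/
def edgeSpin (σ : V → ℤˣ) (e : Sym2 V) : ℝ :=
  Sym2.lift ⟨fun u v => spin σ u * spin σ v, fun _ _ => mul_comm _ _⟩ e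

variable (G : SimpleGraph V) [DecidableRel G.Adj]

/-- The Gibbs weight `exp(β ∑_{uv ∈ E} σ(u) σ(v))` (no external field). -/
def isingWeight (β : ℝ) (σ : V → ℤˣ) : ℝ :=
  Real.exp (β * ∑ e ∈ G.edgeFinset, edgeSpin σ e)

/-- The Ising measure `π` on `G` at inverse temperature `β`. -/
def ising (β : ℝ) (σ : V → ℤˣ) : ℝ :=
  isingWeight G β σ / ∑ τ : V → ℤˣ, isingWeight G β τ

/-- The rate at which heat-bath Glauber dynamics flips the spin at `u`: every site is updated at
rate one, and an update at `u` resamples the spin at `u` from the Ising measure conditioned on all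
the other spins, so that the flip has probability `π(σ^u) / (π(σ) + π(σ^u))`. -/
def flipRate (β : ℝ) (u : V) (σ : V → ℤˣ) : ℝ :=
  1 / (1 + Real.exp (2 * β * spin σ u * ∑ v ∈ G.neighborFinset u, spin σ v))

/-- The matrix of the generator `(L f)(σ) = ∑ u, c(u, σ) (f(σ^u) - f(σ))` of heat-bath Glauber
dynamics, where `c(u, σ)` is the flip rate. -/
def glauberGenerator (β : ℝ) : Matrix (V → ℤˣ) (V → ℤˣ) ℝ :=
  Matrix.of fun σ τ => ∑ u : V, flipRate G β u σ *
    ((if τ = flip σ u then 1 else 0) - (if τ = σ then 1 else 0))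

/-- `glauberLaw G β t x₀ σ` is `ℙ_{x₀}(X_t = σ)`, for the continuous-time heat-bath Glauber
dynamics `X` started from `x₀`: the entry at `(x₀, σ)` of the transition semigroup `exp (t L)`. -/
def glauberLaw (β t : ℝ) (x₀ σ : V → ℤˣ) : ℝ :=
  NormedSpace.exp (t • glauberGenerator G β) x₀ σ

/-- The generator of the continuous-time simple random walk on `G` with jumps at rate `r`: a jump
from `u` goes to a uniformly chosen neighbour of `u`. -/
def walkGenerator (r : ℝ) : Matrix V V ℝ :=
  Matrix.of fun u v => ∑ w ∈ G.neighborFinset u, r / (G.degree u : ℝ) *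
    ((if v = w then 1 else 0) - (if v = u then 1 else 0))

/-- The transition probability from `u` to `v` in time `t` of that walk. -/
def walkKernel (r t : ℝ) (u v : V) : ℝ :=
  NormedSpace.exp (t • walkGenerator G r) u v

end Graph

/-- The total-variation distance of two probability mass functions on a finite space: half their
`L¹`-distance. -/
def tvDist {Ω : Type*} [Fintype Ω] (μ ν : Ω → ℝ) : ℝ := (1 / 2) * ∑ ω, |μ ω - ν ω|

/-- The probability of the event `S` for a uniformly chosen point of the finite space `Ω`. -/
def uniformProb {Ω : Type*} [Fintype Ω] (S : Set Ω) : ℝ := (S.ncard : ℝ) / (Fintype.card Ω : ℝ)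

/-- The probability `θ = 1 - tanh(2β)` that an update on the cycle is oblivious. -/
def theta (β : ℝ) : ℝ := 1 - Real.tanh (2 * β)

/-- `R_t(u, x₀) = ∑_{u'} P_t(u, u') x₀(u')`, where `P_t` is the transition kernel of the walk on
the cycle of length `n` with jumps at rate `1 - θ`. -/
def signedMag (n : ℕ) (β t : ℝ) (u : Fin n) (x₀ : Fin n → ℤˣ) : ℝ :=
  ∑ u' : Fin n, walkKernel (SimpleGraph.cycleGraph n) (1 - theta β) t u u' * spin x₀ u'

/-- The time `(1 / 2θ) log n - (1 / θ) log log n - (1 / θ) log b`. -/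
def testTime (n : ℕ) (β b : ℝ) : ℝ :=
  1 / (2 * theta β) * Real.log n - 1 / theta β * Real.log (Real.log n) -
    1 / theta β * Real.log b

/-- The condition `(1 / n) ∑_u |R_t(u, x₀)| ≥ 1 / b` at `t = testTime n β b`. -/
def MagCondition (n : ℕ) (β b : ℝ) (x₀ : Fin n → ℤˣ) : Prop :=
  1 / b ≤ 1 / (n : ℝ) * ∑ u : Fin n, |signedMag n β (testTime n β b) u x₀|

/-- The sequence `a` is of the form `a_n = n^{o(1)}`. -/
def IsSubpolynomial (a : ℕ → ℝ) : Prop :=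
  ∃ e : ℕ → ℝ, Tendsto e atTop (𝓝 0) ∧ ∀ᶠ n : ℕ in atTop, a n = (n : ℝ) ^ e n

end IsingCycle

end

/-! On a cycle a site has two neighbours, whose spins sum to 0 or ±2, and on these values `tanh(β
s)` is linear in `s`. Hence spin expectations obey a closed linear equation: the mean of `X_t(u)` is
`exp(-θt) R_t(u, x₀)`.

For part 1, the test statistic is `f = ∑ w(u) σ(u)`, with `w(u)` the sign of `R_t(u, x₀)`. Its mean
under the dynamics is `exp(-θt) ∑ |R_t(u, x₀)|`, which `(*)` and the choice of `t_n` make at least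
`√n log n`. Its variance is at most `2n/θ`: a flip moves a linear statistic by at most 2, and its
influence decays like `exp(-θs)` (`glauberLaw_weightedMag_sq_le`). Letting time tend to infinity
gives the same bound for the second moment under `π` (`ising_weightedMag_sq_le`). Chebyshev's
inequality (`one_sub_le_tvDist`) then separates the two laws up to `O(1 / log² n)`.

For part 2, `∑ |R_t(u, x₀)|` dominates the quadratic form `∑ P_t(u, v) x₀(u) x₀(v)`. For uniform
signs its mean is the trace of `P_t` and its variance at most `2n`
(`sum_quadraticForm_sub_trace_sq_le`). As `t = O(log n)`, the crude return bound of order `1/t`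
(`le_walkKernel_self`) gives a trace of order at least `n / log n`, far above the standard
deviation. -/

namespace IsingCycle

/-! ### Semigroups generated by finite Markov generators -/

section Semigroup

variable {S : Type*} [Fintype S] [DecidableEq S]

section
open scoped Matrix.Norms.Operator

theorem hasDerivAt_exp_smul (Q : Matrix S S ℝ) (s : ℝ) :
    HasDerivAt (fun r : ℝ => NormedSpace.exp (r • Q)) (NormedSpace.exp (s • Q) * Q) s :=
  hasDerivAt_exp_smul_const Q s

theorem hasDerivAt_exp_smul_apply (Q : Matrix S S ℝ) (s : ℝ) (x y : S) :
    HasDerivAt (fun r : ℝ => NormedSpace.exp (r • Q) x y) ((NormedSpace.exp (s • Q) * Q) x y) s := by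
  have h := hasDerivAt_exp_smul Q s
  have h1 := (Matrix.entryLinearMap ℝ ℝ x y).toContinuousLinearMap.hasFDerivAt.comp_hasDerivAt s h
  exact h1

theorem hasDerivAt_exp_smul_apply' (Q : Matrix S S ℝ) (s : ℝ) (x y : S) :
    HasDerivAt (fun r : ℝ => NormedSpace.exp (r • Q) x y) ((Q * NormedSpace.exp (s • Q)) x y) s := by
  have h : HasDerivAt (fun r : ℝ => NormedSpace.exp (r • Q)) (Q * NormedSpace.exp (s • Q)) s :=
    hasDerivAt_exp_smul_const' Q s
  have h1 := (Matrix.entryLinearMap ℝ ℝ x y).toContinuousLinearMap.hasFDerivAt.comp_hasDerivAt s h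
  exact h1

theorem hasSum_exp (Q : Matrix S S ℝ) (x y : S) :
    HasSum (fun k : ℕ => ((k.factorial : ℝ)⁻¹) * (Q ^ k) x y) (NormedSpace.exp Q x y) := by
  have h := NormedSpace.exp_series_hasSum_exp' (𝕂 := ℝ) Q
  exact (Matrix.entryLinearMap ℝ ℝ x y).toContinuousLinearMap.hasSum h

end

/-- A matrix generating a continuous-time Markov chain: nonnegative off the diagonal, with rows
summing to zero. -/
structure IsGenerator (Q : Matrix S S ℝ) : Prop where
  nonneg : ∀ x y, x ≠ y → 0 ≤ Q x y
  row_sum : ∀ x, ∑ y, Q x y = 0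

theorem exp_nonneg_of_nonneg {Q : Matrix S S ℝ} (hQ : ∀ x y, 0 ≤ Q x y) (x y : S) :
    0 ≤ NormedSpace.exp Q x y := by
  have hpow : ∀ k : ℕ, ∀ x y, 0 ≤ (Q ^ k) x y := by
    intro k
    induction k with
    | zero => intro x y; simp only [pow_zero, Matrix.one_apply]; split_ifs <;> norm_num
    | succ k ih =>
      intro x y
      rw [pow_succ, Matrix.mul_apply]
      exact Finset.sum_nonneg fun z _ => mul_nonneg (ih x z) (hQ z y)
  exact (hasSum_exp Q x y).nonneg fun k => mul_nonneg (by positivity) (hpow k x y)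

/-- Expectations under the semigroup: differentiation in time of `exp (s Q) h(s)`. -/
theorem hasDerivAt_exp_smul_mulVec (Q : Matrix S S ℝ) {h : ℝ → S → ℝ} {h' : S → ℝ} {s : ℝ}
    (hh : ∀ y, HasDerivAt (fun r => h r y) (h' y) s) (x : S) :
    HasDerivAt (fun r : ℝ => ∑ y, NormedSpace.exp (r • Q) x y * h r y)
      (∑ y, NormedSpace.exp (s • Q) x y * (∑ z, Q y z * h s z + h' y)) s := by
  have h1 := HasDerivAt.fun_sum (u := Finset.univ)
    fun y _ => (hasDerivAt_exp_smul_apply Q s x y).mul (hh y)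
  refine h1.congr_deriv ?_
  simp only [mul_add, Finset.sum_add_distrib]
  congr 1
  simp only [Matrix.mul_apply, Finset.sum_mul, Finset.mul_sum]
  rw [Finset.sum_comm]
  refine Finset.sum_congr rfl fun y _ => Finset.sum_congr rfl fun z _ => by ring

theorem sum_exp_zero_smul_mul (Q : Matrix S S ℝ) (x : S) (h : S → ℝ) :
    ∑ y, NormedSpace.exp ((0 : ℝ) • Q) x y * h y = h x := by
  simp [Matrix.one_apply]

namespace IsGenerator

variable {Q : Matrix S S ℝ} (hQ : IsGenerator Q)
include hQ

theorem exp_smul_row_sum (t : ℝ) (x : S) : ∑ y, NormedSpace.exp (t • Q) x y = 1 := by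
  have hd : ∀ s, HasDerivAt (fun r : ℝ => ∑ y, NormedSpace.exp (r • Q) x y * (fun _ => (1:ℝ)) y) 0 s := by
    intro s
    refine (hasDerivAt_exp_smul_mulVec Q (h := fun _ _ => 1) (h' := fun _ => 0)
      (fun y => hasDerivAt_const s _) x).congr_deriv ?_
    simp [hQ.row_sum]
  have h := is_const_of_deriv_eq_zero (fun s => (hd s).differentiableAt) (fun s => (hd s).deriv) t 0
  rw [sum_exp_zero_smul_mul] at h
  simpa using h

theorem exp_smul_nonneg {t : ℝ} (ht : 0 ≤ t) (x y : S) : 0 ≤ NormedSpace.exp (t • Q) x y := by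
  obtain ⟨c, hc⟩ : ∃ c : ℝ, ∀ x, 0 ≤ Q x x + c := by
    refine ⟨∑ x, |Q x x|, fun x => ?_⟩
    have := Finset.single_le_sum (f := fun x => |Q x x|) (fun _ _ => abs_nonneg _)
      (Finset.mem_univ x)
    have h2 := neg_abs_le (Q x x)
    linarith
  -- Adding a multiple of the identity makes the generator entrywise nonnegative, at the price of a
  -- positive scalar factor in the exponential.
  have hsum : t • Q = t • (Q + c • (1 : Matrix S S ℝ)) + (-(t * c)) • (1 : Matrix S S ℝ) := by
    rw [smul_add, smul_smul, add_assoc, ← add_smul]; simp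
  have hcomm : Commute (t • (Q + c • (1 : Matrix S S ℝ))) ((-(t * c)) • (1 : Matrix S S ℝ)) :=
    (Commute.one_right _).smul_right _
  rw [hsum, Matrix.exp_add_of_commute _ _ hcomm, Matrix.mul_apply]
  refine Finset.sum_nonneg fun z _ => mul_nonneg ?_ ?_
  · refine exp_nonneg_of_nonneg (fun x y => ?_) x z
    change 0 ≤ t * (Q x y + c * (1 : Matrix S S ℝ) x y)
    refine mul_nonneg ht ?_
    rw [Matrix.one_apply]
    split_ifs with h
    · subst h; simpa using hc x
    · simpa using hQ.nonneg x y h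
  · rw [← Matrix.diagonal_one, ← Matrix.diagonal_smul, Matrix.exp_diagonal, Matrix.diagonal_apply]
    split_ifs
    · rw [Pi.coe_exp, ← Real.exp_eq_exp_ℝ]
      exact (Real.exp_pos _).le
    · exact le_rfl

/-- An expectation grows at most at the supremum of the drift. -/
theorem sum_exp_smul_mul_le {h : S → ℝ} {c : ℝ} (hc : ∀ x, ∑ y, Q x y * h y ≤ c) {t : ℝ}
    (ht : 0 ≤ t) (x : S) : ∑ y, NormedSpace.exp (t • Q) x y * h y ≤ h x + c * t := by
  have hd : ∀ s, HasDerivAt (fun r : ℝ => ∑ y, NormedSpace.exp (r • Q) x y * (h y - c * r))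
      (∑ y, NormedSpace.exp (s • Q) x y * (∑ z, Q y z * (h z - c * s) + -c)) s := by
    intro s
    refine hasDerivAt_exp_smul_mulVec Q (h := fun r y => h y - c * r) (fun y => ?_) x
    simpa using ((hasDerivAt_id s).const_mul c).const_sub (h y)
  -- `h(X_r) - c r` is a supermartingale.
  have hanti : AntitoneOn (fun r : ℝ => ∑ y, NormedSpace.exp (r • Q) x y * (h y - c * r))
      (Set.Icc 0 t) := by
    refine antitoneOn_of_deriv_nonpos (convex_Icc 0 t)
      (fun s _ => (hd s).continuousAt.continuousWithinAt)
      (fun s _ => (hd s).differentiableAt.differentiableWithinAt) fun s hs => ?_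
    rw [(hd s).deriv]
    rw [interior_Icc] at hs
    refine Finset.sum_nonpos fun y _ =>
      mul_nonpos_of_nonneg_of_nonpos (hQ.exp_smul_nonneg hs.1.le x y) ?_
    have := hc y
    simp only [mul_sub, Finset.sum_sub_distrib, ← Finset.sum_mul, hQ.row_sum]
    linarith
  have h0 := hanti (Set.left_mem_Icc.2 ht) (Set.right_mem_Icc.2 ht) ht
  simp only [sum_exp_zero_smul_mul] at h0
  simp only [mul_sub, Finset.sum_sub_distrib, ← Finset.sum_mul, hQ.exp_smul_row_sum] at h0
  linarith

end IsGenerator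

theorem exp_smul_symm {Q : Matrix S S ℝ} (hQ : ∀ x y, Q x y = Q y x) (t : ℝ) (x y : S) :
    NormedSpace.exp (t • Q) x y = NormedSpace.exp (t • Q) y x := by
  have h : (t • Q).IsSymm := Matrix.IsSymm.ext fun i j => by simp [hQ i j]
  exact h.exp.apply y x

theorem exp_smul_add_apply (Q : Matrix S S ℝ) (s t : ℝ) (x y : S) :
    NormedSpace.exp ((s + t) • Q) x y =
      ∑ z, NormedSpace.exp (s • Q) x z * NormedSpace.exp (t • Q) z y := by
  rw [add_smul, Matrix.exp_add_of_commute _ _ (((Commute.refl Q).smul_right t).smul_left s),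
    Matrix.mul_apply]

/-- A left null vector of the generator is stationary. -/
theorem sum_mul_exp_smul {Q : Matrix S S ℝ} {p : S → ℝ} (hp : ∀ y, ∑ x, p x * Q x y = 0) (t : ℝ)
    (y : S) : ∑ x, p x * NormedSpace.exp (t • Q) x y = p y := by
  -- Transposition turns the action on measures into an action on functions.
  have hd : ∀ s, HasDerivAt (fun r : ℝ => ∑ z, NormedSpace.exp (r • Q.transpose) y z * p z) 0 s := by
    intro s
    refine (hasDerivAt_exp_smul_mulVec Q.transpose (h := fun _ => p) (h' := fun _ => 0)
      (fun y => hasDerivAt_const s _) y).congr_deriv ?_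
    refine Finset.sum_eq_zero fun z _ => ?_
    have := hp z
    simp only [mul_comm (p _)] at this
    simp [this]
  have h := is_const_of_deriv_eq_zero (fun s => (hd s).differentiableAt) (fun s => (hd s).deriv) t 0
  rw [sum_exp_zero_smul_mul] at h
  rw [← h]
  refine Finset.sum_congr rfl fun x _ => ?_
  rw [← Matrix.transpose_smul, Matrix.exp_transpose, Matrix.transpose_apply, mul_comm]

end Semigroup
end IsingCycle

namespace IsingCycle

theorem theta_pos (β : ℝ) : 0 < theta β := by
  unfold theta; linarith [Real.tanh_lt_one (2 * β)]

theorem theta_le_one {β : ℝ} (hβ : 0 ≤ β) : theta β ≤ 1 := by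
  have : 0 ≤ Real.tanh (2 * β) := by
    rw [Real.tanh_eq_sinh_div_cosh]
    exact div_nonneg (Real.sinh_nonneg_iff.2 (by linarith)) (Real.cosh_pos _).le
  unfold theta; linarith

/-! ### Spins and single flips -/

section Spin

variable {V : Type*}

theorem spin_eq_or (σ : V → ℤˣ) (u : V) : spin σ u = 1 ∨ spin σ u = -1 := by
  unfold spin
  rcases Int.units_eq_one_or (σ u) with h | h <;> simp [h]

theorem spin_mul_self (σ : V → ℤˣ) (u : V) : spin σ u * spin σ u = 1 := by
  rcases spin_eq_or σ u with h | h <;> rw [h] <;> norm_num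

theorem abs_spin (σ : V → ℤˣ) (u : V) : |spin σ u| = 1 := by
  rcases spin_eq_or σ u with h | h <;> rw [h] <;> norm_num

variable [DecidableEq V]

theorem spin_flip_self (σ : V → ℤˣ) (u : V) : spin (flip σ u) u = -spin σ u := by
  simp [spin, flip]

theorem spin_flip_of_ne (σ : V → ℤˣ) {u v : V} (h : v ≠ u) : spin (flip σ u) v = spin σ v := by
  simp [spin, flip, h]

theorem spin_flip_sub (σ : V → ℤˣ) (u v : V) :
    spin (flip σ u) v - spin σ v = if v = u then -2 * spin σ u else 0 := by
  split_ifs with h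
  · subst h; rw [spin_flip_self]; ring
  · rw [spin_flip_of_ne σ h]; ring

theorem flip_flip (σ : V → ℤˣ) (u : V) : flip (flip σ u) u = σ := by
  unfold flip; simp

/-- Flipping the spin at `u`, as a permutation of the configurations. -/
def flipEquiv (u : V) : (V → ℤˣ) ≃ (V → ℤˣ) where
  toFun σ := flip σ u
  invFun σ := flip σ u
  left_inv σ := flip_flip σ u
  right_inv σ := flip_flip σ u

end Spin

/-! ### Moments of linear statistics under Glauber dynamics -/

section Glauber

variable {V : Type*} [Fintype V] [DecidableEq V] (G : SimpleGraph V) [DecidableRel G.Adj]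

omit [DecidableEq V] in
theorem flipRate_nonneg (β : ℝ) (u : V) (σ : V → ℤˣ) : 0 ≤ flipRate G β u σ := by
  unfold flipRate; positivity

omit [DecidableEq V] in
theorem flipRate_le_one (β : ℝ) (u : V) (σ : V → ℤˣ) : flipRate G β u σ ≤ 1 := by
  unfold flipRate
  rw [div_le_one (by positivity)]
  linarith [Real.exp_pos (2 * β * spin σ u * ∑ v ∈ G.neighborFinset u, spin σ v)]

theorem glauberGenerator_sum_mul (β : ℝ) (σ : V → ℤˣ) (h : (V → ℤˣ) → ℝ) :
    ∑ τ, glauberGenerator G β σ τ * h τ = ∑ u, flipRate G β u σ * (h (flip σ u) - h σ) := by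
  simp only [glauberGenerator, Matrix.of_apply, Finset.sum_mul]
  rw [Finset.sum_comm]
  refine Finset.sum_congr rfl fun u _ => ?_
  simp only [mul_assoc, ← Finset.mul_sum, sub_mul, Finset.sum_sub_distrib, ite_mul, one_mul,
    zero_mul, Finset.sum_ite_eq', Finset.mem_univ, if_true]

theorem glauberGenerator_isGenerator (β : ℝ) : IsGenerator (glauberGenerator G β) where
  nonneg σ τ h := by
    simp only [glauberGenerator, Matrix.of_apply, if_neg h.symm, sub_zero]
    exact Finset.sum_nonneg fun u _ =>
      mul_nonneg (flipRate_nonneg G β u σ) (by split_ifs <;> norm_num)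
  row_sum σ := by
    simpa using glauberGenerator_sum_mul G β σ fun _ => 1

theorem walkGenerator_sum_mul (r : ℝ) (u : V) (h : V → ℝ) :
    ∑ v, walkGenerator G r u v * h v =
      ∑ w ∈ G.neighborFinset u, r / (G.degree u : ℝ) * (h w - h u) := by
  simp only [walkGenerator, Matrix.of_apply, Finset.sum_mul]
  rw [Finset.sum_comm]
  refine Finset.sum_congr rfl fun u _ => ?_
  simp only [mul_assoc, ← Finset.mul_sum, sub_mul, Finset.sum_sub_distrib, ite_mul, one_mul,
    zero_mul, Finset.sum_ite_eq', Finset.mem_univ, if_true]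

theorem walkGenerator_isGenerator {r : ℝ} (hr : 0 ≤ r) : IsGenerator (walkGenerator G r) where
  nonneg u v h := by
    simp only [walkGenerator, Matrix.of_apply, if_neg h.symm, sub_zero]
    exact Finset.sum_nonneg fun w _ => mul_nonneg (by positivity) (by split_ifs <;> norm_num)
  row_sum u := by
    simpa using walkGenerator_sum_mul G r u fun _ => 1

variable {G}

/-- Equal degrees give both directions of an edge the same rate `r / 2`. -/
theorem walkGenerator_symm (hG : G.IsRegularOfDegree 2) (r : ℝ) (u v : V) :
    walkGenerator G r u v = walkGenerator G r v u := by
  have h : ∀ u v, walkGenerator G r u v =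
      (if G.Adj u v then r / 2 else 0) - if u = v then r else 0 := by
    intro u v
    simp only [walkGenerator, Matrix.of_apply, hG.degree_eq, mul_sub, Finset.sum_sub_distrib]
    congr 1
    · simp
    · rw [Finset.sum_const, G.card_neighborFinset_eq_degree, hG.degree_eq]
      by_cases huv : u = v
      · simp [huv]; ring
      · simp [huv, Ne.symm huv]
  rw [h, h]
  simp only [G.adj_comm u v, eq_comm (a := u)]

theorem tanh_half_form (x : ℝ) : -2 * (1 / (1 + Real.exp (2 * x))) = -1 + Real.tanh x := by
  have h : Real.exp (2 * x) = Real.exp x * Real.exp x := by rw [← Real.exp_add]; ring_nf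
  rw [Real.tanh_eq_sinh_div_cosh, Real.sinh_eq, Real.cosh_eq, h, Real.exp_neg]
  have := Real.exp_pos x
  field_simp
  ring

/-- On a two-regular graph the drift of a spin under Glauber dynamics is linear in the spins. -/
theorem glauberGenerator_spin (hG : G.IsRegularOfDegree 2) (β : ℝ) (σ : V → ℤˣ) (v : V) :
    ∑ τ, glauberGenerator G β σ τ * spin τ v =
      ∑ w, walkGenerator G (1 - theta β) v w * spin σ w - theta β * spin σ v := by
  rw [glauberGenerator_sum_mul G β σ fun τ => spin τ v, walkGenerator_sum_mul]
  simp only [spin_flip_sub, mul_ite, mul_zero, Finset.sum_ite_eq, Finset.mem_univ, if_true]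
  obtain ⟨a, b, hab, hN⟩ := Finset.card_eq_two.1
    ((G.card_neighborFinset_eq_degree v).trans (hG.degree_eq v))
  rw [flipRate, hG.degree_eq, hN, Finset.sum_pair hab, Finset.sum_pair hab]
  have key := tanh_half_form (β * (spin σ v * (spin σ a + spin σ b)))
  have e : 2 * β * spin σ v * (spin σ a + spin σ b) =
      2 * (β * (spin σ v * (spin σ a + spin σ b))) := by ring
  rw [e]
  have key2 : 1 / (1 + Real.exp (2 * (β * (spin σ v * (spin σ a + spin σ b))))) *
      (-2 * spin σ v) = (-1 + Real.tanh (β * (spin σ v * (spin σ a + spin σ b)))) * spin σ v := by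
    rw [← key]; ring
  rw [key2, theta]
  have h2 : β * 2 = 2 * β := mul_comm _ _
  -- This is where degree two matters: the argument of `tanh` is 0 or `±2β`, and `tanh` is odd, so
  -- it agrees there with a linear function of slope governed by `1 - theta β`.
  rcases spin_eq_or σ v with h | h <;> rcases spin_eq_or σ a with h' | h' <;>
    rcases spin_eq_or σ b with h'' | h'' <;> rw [h, h', h''] <;> norm_num [h2] <;> ring

/-- The linear statistic `∑ u, w(u) σ(u)`. -/
noncomputable def weightedMag (w : V → ℝ) (σ : V → ℤˣ) : ℝ := ∑ u, w u * spin σ u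

/-- The backward evolution, for time `t`, of the weights of a linear statistic. -/
noncomputable def evolve (G : SimpleGraph V) [DecidableRel G.Adj] (β t : ℝ) (w : V → ℝ) (u : V) : ℝ :=
  Real.exp (-(theta β * t)) * ∑ v, walkKernel G (1 - theta β) t u v * w v

/-- The generator of the evolution of the weights. -/
noncomputable def drift (G : SimpleGraph V) [DecidableRel G.Adj] (β : ℝ) (w : V → ℝ) (u : V) : ℝ :=
  ∑ v, walkGenerator G (1 - theta β) u v * w v - theta β * w u

theorem weightedMag_flip (w : V → ℝ) (σ : V → ℤˣ) (u : V) :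
    weightedMag w (flip σ u) - weightedMag w σ = -2 * (w u * spin σ u) := by
  simp only [weightedMag, ← Finset.sum_sub_distrib, ← mul_sub, spin_flip_sub, mul_ite, mul_zero,
    Finset.sum_ite_eq', Finset.mem_univ, if_true]
  ring

/-- Symmetry of the walk moves its generator from the spins to the weights, so the dynamics
preserves the space of linear statistics. -/
theorem glauberGenerator_weightedMag (hG : G.IsRegularOfDegree 2) (β : ℝ) (w : V → ℝ)
    (σ : V → ℤˣ) :
    ∑ τ, glauberGenerator G β σ τ * weightedMag w τ = weightedMag (drift G β w) σ := by
  have h : ∑ τ, glauberGenerator G β σ τ * weightedMag w τ =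
      ∑ u, w u * ∑ τ, glauberGenerator G β σ τ * spin τ u := by
    simp only [weightedMag, Finset.mul_sum]
    rw [Finset.sum_comm]
    exact Finset.sum_congr rfl fun u _ => Finset.sum_congr rfl fun τ _ => by ring
  rw [h]
  simp only [glauberGenerator_spin hG, weightedMag, drift, mul_sub, sub_mul,
    Finset.sum_sub_distrib, Finset.mul_sum, Finset.sum_mul]
  congr 1
  · rw [Finset.sum_comm]
    refine Finset.sum_congr rfl fun u _ => Finset.sum_congr rfl fun v _ => ?_
    rw [walkGenerator_symm hG]; ring
  · exact Finset.sum_congr rfl fun u _ => by ring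

/-- The last term is the carré du champ: the squared jump at `u` is `4 * w u ^ 2`, whatever the
spins. -/
theorem glauberGenerator_weightedMag_sq (hG : G.IsRegularOfDegree 2) (β : ℝ) (w : V → ℝ)
    (σ : V → ℤˣ) :
    ∑ τ, glauberGenerator G β σ τ * weightedMag w τ ^ 2 =
      2 * weightedMag w σ * weightedMag (drift G β w) σ +
        4 * ∑ u, flipRate G β u σ * w u ^ 2 := by
  rw [← glauberGenerator_weightedMag hG, glauberGenerator_sum_mul G β σ (weightedMag w),
    glauberGenerator_sum_mul G β σ fun τ => weightedMag w τ ^ 2, Finset.mul_sum, Finset.mul_sum,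
    ← Finset.sum_add_distrib]
  refine Finset.sum_congr rfl fun u _ => ?_
  have h := weightedMag_flip w σ u
  have h' : weightedMag w (flip σ u) = weightedMag w σ + -2 * (w u * spin σ u) := by linarith
  rw [h']
  have := spin_mul_self σ u
  linear_combination 4 * flipRate G β u σ * w u ^ 2 * this

theorem hasDerivAt_evolve (β t : ℝ) (w : V → ℝ) (u : V) :
    HasDerivAt (fun s => evolve G β s w u) (drift G β (evolve G β t w) u) t := by
  have h1 : HasDerivAt (fun s => Real.exp (-(theta β * s)))
      (Real.exp (-(theta β * t)) * (-theta β)) t := by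
    have := ((hasDerivAt_id t).const_mul (theta β)).neg.exp
    simpa using this
  have h2 := HasDerivAt.fun_sum (u := Finset.univ) fun v _ =>
    (hasDerivAt_exp_smul_apply' (walkGenerator G (1 - theta β)) t u v).mul_const (w v)
  refine (h1.mul h2).congr_deriv ?_
  simp only [drift, evolve, walkKernel, Matrix.mul_apply, Finset.sum_mul, Finset.mul_sum]
  rw [sub_eq_add_neg, add_comm]
  congr 1
  · rw [Finset.sum_comm]
    exact Finset.sum_congr rfl fun _ _ => Finset.sum_congr rfl fun _ _ => by ring
  · rw [← Finset.sum_neg_distrib]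
    exact Finset.sum_congr rfl fun _ _ => by ring

theorem evolve_zero (β : ℝ) (w : V → ℝ) : evolve G β 0 w = w := by
  funext u
  simp [evolve, walkKernel, Matrix.one_apply]

theorem hasDerivAt_weightedMag_evolve (β t s : ℝ) (w : V → ℝ) (σ : V → ℤˣ) :
    HasDerivAt (fun s => weightedMag (evolve G β (t - s) w) σ)
      (-weightedMag (drift G β (evolve G β (t - s) w)) σ) s := by
  have h := HasDerivAt.fun_sum (u := Finset.univ) fun u _ =>
    ((hasDerivAt_evolve (G := G) β (t - s) w u).comp_const_sub t s).mul_const (spin σ u)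
  refine h.congr_deriv ?_
  simp [weightedMag]

theorem abs_evolve_le (hβ : 0 ≤ β) {t : ℝ} (ht : 0 ≤ t) {w : V → ℝ} (hw : ∀ u, |w u| ≤ 1)
    (u : V) : |evolve G β t w u| ≤ Real.exp (-(theta β * t)) := by
  have hQ := walkGenerator_isGenerator G (sub_nonneg.2 (theta_le_one hβ))
  rw [evolve, abs_mul, abs_of_pos (Real.exp_pos _)]
  refine mul_le_of_le_one_right (Real.exp_pos _).le ?_
  refine (Finset.abs_sum_le_sum_abs _ _).trans ?_
  refine (Finset.sum_le_sum fun v _ => ?_).trans_eq (hQ.exp_smul_row_sum t u)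
  have h0 : 0 ≤ walkKernel G (1 - theta β) t u v := hQ.exp_smul_nonneg ht u v
  rw [abs_mul, abs_of_nonneg h0]
  exact mul_le_of_le_one_right h0 (hw v)

omit [DecidableEq V] in
theorem abs_weightedMag_le {w : V → ℝ} {c : ℝ} (hw : ∀ u, |w u| ≤ c) (σ : V → ℤˣ) :
    |weightedMag w σ| ≤ Fintype.card V * c := by
  refine (Finset.abs_sum_le_sum_abs _ _).trans ?_
  simp only [abs_mul, abs_spin, mul_one]
  refine (Finset.sum_le_sum fun u _ => hw u).trans ?_
  simp

/-- The mean of a linear statistic under Glauber dynamics. -/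
theorem glauberLaw_weightedMag (hG : G.IsRegularOfDegree 2) (β t : ℝ) (w : V → ℝ) (σ : V → ℤˣ) :
    ∑ τ, glauberLaw G β t σ τ * weightedMag w τ = weightedMag (evolve G β t w) σ := by
  -- With the weights evolved backward for the remaining time `t - r`, the statistic is a martingale
  -- in `r`; compare `r = 0` with `r = t`.
  have hd : ∀ s, HasDerivAt (fun r : ℝ => ∑ τ, NormedSpace.exp (r • glauberGenerator G β) σ τ *
      weightedMag (evolve G β (t - r) w) τ) 0 s := by
    intro s
    refine (hasDerivAt_exp_smul_mulVec (glauberGenerator G β)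
      (fun τ => hasDerivAt_weightedMag_evolve β t s w τ) σ).congr_deriv ?_
    simp only [glauberGenerator_weightedMag hG, add_neg_cancel, mul_zero, Finset.sum_const_zero]
  have h := is_const_of_deriv_eq_zero (fun s => (hd s).differentiableAt) (fun s => (hd s).deriv) t 0
  rw [sum_exp_zero_smul_mul] at h
  simp only [sub_self, sub_zero, evolve_zero] at h
  exact h

/-- The second moment of a linear statistic under Glauber dynamics exceeds the square of its mean
by at most a constant times the number of sites. -/
theorem glauberLaw_weightedMag_sq_le (hG : G.IsRegularOfDegree 2) {β : ℝ} (hβ : 0 ≤ β) {t : ℝ}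
    (ht : 0 ≤ t) {w : V → ℝ} (hw : ∀ u, |w u| ≤ 1) (σ : V → ℤˣ) :
    ∑ τ, glauberLaw G β t σ τ * weightedMag w τ ^ 2 ≤
      weightedMag (evolve G β t w) σ ^ 2 + 2 * Fintype.card V / theta β := by
  have hθ := theta_pos β
  have hL := glauberGenerator_isGenerator G β
  -- `K` is the integral over `s ≥ 0` of `4 |V| exp(-2θs)`, which bounds the carré du champ with
  -- time `s` remaining. Subtracting `K exp(-2θ(t - r))` makes the squared martingale a
  -- supermartingale.
  set K : ℝ := 2 * Fintype.card V / theta β with hK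
  have hexp : ∀ s, HasDerivAt (fun r => K * Real.exp (-(2 * theta β * (t - r))))
      (K * (Real.exp (-(2 * theta β * (t - s))) * (2 * theta β))) s := by
    intro s
    have := (((hasDerivAt_id s).const_sub t).const_mul (2 * theta β)).neg.exp.const_mul K
    simpa using this
  have hd : ∀ s, HasDerivAt (fun r : ℝ => ∑ τ, NormedSpace.exp (r • glauberGenerator G β) σ τ *
      (weightedMag (evolve G β (t - r) w) τ ^ 2 - K * Real.exp (-(2 * theta β * (t - r)))))
      (∑ τ, NormedSpace.exp (s • glauberGenerator G β) σ τ *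
        (4 * ∑ u, flipRate G β u τ * evolve G β (t - s) w u ^ 2 -
          K * (Real.exp (-(2 * theta β * (t - s))) * (2 * theta β)))) s := by
    intro s
    refine (hasDerivAt_exp_smul_mulVec (glauberGenerator G β) (fun τ =>
      ((hasDerivAt_weightedMag_evolve β t s w τ).fun_pow 2).fun_sub (hexp s)) σ).congr_deriv ?_
    refine Finset.sum_congr rfl fun τ _ => ?_
    simp only [mul_sub, Finset.sum_sub_distrib, ← Finset.sum_mul, hL.row_sum,
      glauberGenerator_weightedMag_sq hG]
    ring
  have hanti : AntitoneOn (fun r : ℝ => ∑ τ, NormedSpace.exp (r • glauberGenerator G β) σ τ *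
      (weightedMag (evolve G β (t - r) w) τ ^ 2 - K * Real.exp (-(2 * theta β * (t - r)))))
      (Set.Icc 0 t) := by
    refine antitoneOn_of_deriv_nonpos (convex_Icc 0 t)
      (fun s _ => (hd s).continuousAt.continuousWithinAt)
      (fun s _ => (hd s).differentiableAt.differentiableWithinAt) fun s hs => ?_
    rw [(hd s).deriv]
    rw [interior_Icc] at hs
    refine Finset.sum_nonpos fun τ _ =>
      mul_nonpos_of_nonneg_of_nonpos (hL.exp_smul_nonneg hs.1.le σ τ) ?_
    have hterm : ∀ u, flipRate G β u τ * evolve G β (t - s) w u ^ 2 ≤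
        Real.exp (-(2 * theta β * (t - s))) := by
      intro u
      have h1 := abs_evolve_le (G := G) hβ (sub_nonneg.2 hs.2.le) hw u
      have h2 : Real.exp (-(2 * theta β * (t - s))) = Real.exp (-(theta β * (t - s))) ^ 2 := by
        rw [← Real.exp_nat_mul]; congr 1; push_cast; ring
      rw [h2, ← sq_abs (evolve G β (t - s) w u)]
      calc _ ≤ 1 * Real.exp (-(theta β * (t - s))) ^ 2 :=
            mul_le_mul (flipRate_le_one G β u τ) (pow_le_pow_left₀ (abs_nonneg _) h1 2)
              (by positivity) zero_le_one
        _ = _ := one_mul _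
    have hsum := Finset.sum_le_sum fun u (_ : u ∈ Finset.univ) => hterm u
    rw [Finset.sum_const, Finset.card_univ, nsmul_eq_mul] at hsum
    have hKθ : K * (Real.exp (-(2 * theta β * (t - s))) * (2 * theta β)) =
        4 * (Fintype.card V * Real.exp (-(2 * theta β * (t - s)))) := by
      rw [hK]; field_simp; ring
    rw [hKθ]
    linarith
  have h0 := hanti (Set.left_mem_Icc.2 ht) (Set.right_mem_Icc.2 ht) ht
  simp only [sum_exp_zero_smul_mul] at h0
  simp only [mul_sub, Finset.sum_sub_distrib, ← Finset.sum_mul, hL.exp_smul_row_sum, sub_self,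
    evolve_zero, mul_zero, neg_zero, Real.exp_zero, sub_zero] at h0
  have hpos : 0 ≤ K * Real.exp (-(2 * theta β * t - 0)) := by
    rw [hK]; positivity
  simp only [sub_zero] at hpos
  change ∑ τ, NormedSpace.exp (t • glauberGenerator G β) σ τ * weightedMag w τ ^ 2 ≤ _
  linarith

end Glauber
end IsingCycle

namespace IsingCycle

/-! ### Reversibility and the second moment at equilibrium -/

section Ising

variable {V : Type*} [Fintype V] [DecidableEq V] (G : SimpleGraph V) [DecidableRel G.Adj]

omit [Fintype V] in
theorem edgeSpin_flip_of_notMem (σ : V → ℤˣ) {u : V} {e : Sym2 V} (h : u ∉ e) :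
    edgeSpin (flip σ u) e = edgeSpin σ e := by
  induction e with
  | _ a b =>
    rw [Sym2.mem_iff, not_or] at h
    simp only [edgeSpin, Sym2.lift_mk]
    rw [spin_flip_of_ne σ (Ne.symm h.1), spin_flip_of_ne σ (Ne.symm h.2)]

/-- Only the edges at `u` change, each by a sign, and the neighbours of `u` index them. -/
theorem sum_edgeSpin_flip (σ : V → ℤˣ) (u : V) :
    ∑ e ∈ G.edgeFinset, edgeSpin (flip σ u) e =
      ∑ e ∈ G.edgeFinset, edgeSpin σ e - 2 * (spin σ u * ∑ v ∈ G.neighborFinset u, spin σ v) := by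
  have himage : G.edgeFinset.filter (u ∈ ·) = (G.neighborFinset u).image (s(u, ·)) := by
    ext e
    induction e with
    | _ a b =>
      simp only [Finset.mem_filter, SimpleGraph.mem_edgeFinset, SimpleGraph.mem_edgeSet,
        Sym2.mem_iff, Finset.mem_image, SimpleGraph.mem_neighborFinset]
      constructor
      · rintro ⟨h, rfl | rfl⟩
        · exact ⟨b, h, rfl⟩
        · exact ⟨a, h.symm, Sym2.eq_swap⟩
      · rintro ⟨v, hv, h⟩
        rw [Sym2.eq_iff] at h
        rcases h with ⟨rfl, rfl⟩ | ⟨rfl, rfl⟩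
        · exact ⟨hv, Or.inl rfl⟩
        · exact ⟨hv.symm, Or.inr rfl⟩
  have hdiff : ∑ e ∈ G.edgeFinset, (edgeSpin (flip σ u) e - edgeSpin σ e) =
      ∑ e ∈ G.edgeFinset.filter (u ∈ ·), (edgeSpin (flip σ u) e - edgeSpin σ e) := by
    rw [Finset.sum_filter]
    refine Finset.sum_congr rfl fun e _ => ?_
    split_ifs with h
    · rfl
    · rw [edgeSpin_flip_of_notMem σ h, sub_self]
  rw [himage, Finset.sum_image (fun a _ b _ h => Sym2.congr_right.1 h),
    Finset.sum_sub_distrib] at hdiff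
  have hedge : ∀ v ∈ G.neighborFinset u,
      edgeSpin (flip σ u) s(u, v) - edgeSpin σ s(u, v) = -2 * spin σ u * spin σ v := by
    intro v hv
    have hne : v ≠ u := (G.ne_of_adj ((G.mem_neighborFinset u v).1 hv)).symm
    simp only [edgeSpin, Sym2.lift_mk]
    rw [spin_flip_self, spin_flip_of_ne σ hne]
    ring
  rw [Finset.sum_congr rfl hedge, ← Finset.mul_sum] at hdiff
  linarith

/-- Without loops the flip leaves the neighbouring spins alone; with `x = 2βσ(u)S`, both the ratio
of the weights and the inverse ratio of the rates are `exp x`. -/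
theorem isingWeight_mul_flipRate (β : ℝ) (σ : V → ℤˣ) (u : V) :
    isingWeight G β σ * flipRate G β u σ =
      isingWeight G β (flip σ u) * flipRate G β u (flip σ u) := by
  have hS : ∑ v ∈ G.neighborFinset u, spin (flip σ u) v = ∑ v ∈ G.neighborFinset u, spin σ v :=
    Finset.sum_congr rfl fun v hv =>
      spin_flip_of_ne σ (G.ne_of_adj ((G.mem_neighborFinset u v).1 hv)).symm
  simp only [isingWeight, flipRate, sum_edgeSpin_flip, hS, spin_flip_self]
  set S := ∑ v ∈ G.neighborFinset u, spin σ v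
  set H := ∑ e ∈ G.edgeFinset, edgeSpin σ e
  have e1 : β * (H - 2 * (spin σ u * S)) = β * H - 2 * β * spin σ u * S := by ring
  have e2 : 2 * β * -spin σ u * S = -(2 * β * spin σ u * S) := by ring
  rw [e1, e2, Real.exp_sub, Real.exp_neg]
  have := Real.exp_pos (2 * β * spin σ u * S)
  field_simp
  ring

theorem isingWeight_sum_pos (β : ℝ) : 0 < ∑ τ : V → ℤˣ, isingWeight G β τ :=
  Finset.sum_pos (fun _ _ => Real.exp_pos _) Finset.univ_nonempty

theorem ising_nonneg (β : ℝ) (σ : V → ℤˣ) : 0 ≤ ising G β σ :=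
  div_nonneg (Real.exp_pos _).le (isingWeight_sum_pos G β).le

theorem ising_sum (β : ℝ) : ∑ σ, ising G β σ = 1 := by
  simp only [ising]
  rw [← Finset.sum_div, div_self (isingWeight_sum_pos G β).ne']

/-- Detailed balance: Glauber dynamics is reversible with respect to the Ising measure. -/
theorem ising_mul_glauberGenerator (β : ℝ) (σ τ : V → ℤˣ) :
    ising G β σ * glauberGenerator G β σ τ = ising G β τ * glauberGenerator G β τ σ := by
  simp only [glauberGenerator, Matrix.of_apply, Finset.mul_sum]
  refine Finset.sum_congr rfl fun u _ => ?_
  by_cases hστ : τ = σ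
  · subst hστ; rfl
  rw [if_neg hστ, if_neg (Ne.symm hστ)]
  by_cases h : τ = flip σ u
  · have h' : σ = flip τ u := by rw [h, flip_flip]
    rw [if_pos h, if_pos h', sub_zero, mul_one, mul_one, h, ising, ising, div_mul_eq_mul_div,
      div_mul_eq_mul_div, isingWeight_mul_flipRate]
  · have h' : ¬ σ = flip τ u := fun h' => h (by rw [h', flip_flip])
    rw [if_neg h, if_neg h']
    simp

theorem ising_stationary (β t : ℝ) (τ : V → ℤˣ) :
    ∑ σ, ising G β σ * glauberLaw G β t σ τ = ising G β τ := by
  refine sum_mul_exp_smul (fun τ => ?_) t τ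
  simp only [ising_mul_glauberGenerator G β _ τ, ← Finset.mul_sum,
    (glauberGenerator_isGenerator G β).row_sum, mul_zero]

variable {G}

/-- By stationarity the dynamical bound, averaged over the starting state, holds at every time; its
mean term vanishes as time tends to infinity. No correlations of `π` need computing. -/
theorem ising_weightedMag_sq_le (hG : G.IsRegularOfDegree 2) {β : ℝ} (hβ : 0 ≤ β) {w : V → ℝ}
    (hw : ∀ u, |w u| ≤ 1) :
    ∑ τ, ising G β τ * weightedMag w τ ^ 2 ≤ 2 * Fintype.card V / theta β := by
  have hbound : ∀ t : ℝ, 0 ≤ t → ∑ τ, ising G β τ * weightedMag w τ ^ 2 ≤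
      (Fintype.card V * Real.exp (-(theta β * t))) ^ 2 + 2 * Fintype.card V / theta β := by
    intro t ht
    calc ∑ τ, ising G β τ * weightedMag w τ ^ 2
        = ∑ σ, ising G β σ * ∑ τ, glauberLaw G β t σ τ * weightedMag w τ ^ 2 := by
          have h : ∀ τ, ising G β τ * weightedMag w τ ^ 2 =
              ∑ σ, ising G β σ * (glauberLaw G β t σ τ * weightedMag w τ ^ 2) := by
            intro τ
            rw [← ising_stationary G β t τ, Finset.sum_mul]
            simp only [mul_assoc]
          rw [Finset.sum_congr rfl fun τ _ => h τ, Finset.sum_comm]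
          simp only [Finset.mul_sum]
      _ ≤ ∑ σ, ising G β σ * ((Fintype.card V * Real.exp (-(theta β * t))) ^ 2 +
            2 * Fintype.card V / theta β) := by
          refine Finset.sum_le_sum fun σ _ =>
            mul_le_mul_of_nonneg_left ?_ (ising_nonneg G β σ)
          refine (glauberLaw_weightedMag_sq_le hG hβ ht hw σ).trans (add_le_add_left ?_ _)
          rw [← sq_abs]
          exact pow_le_pow_left₀ (abs_nonneg _)
            (abs_weightedMag_le (abs_evolve_le hβ ht hw) σ) 2
      _ = _ := by rw [← Finset.sum_mul, ising_sum, one_mul]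
  have hexp : Tendsto (fun t : ℝ => Real.exp (-(theta β * t))) atTop (𝓝 0) :=
    Real.tendsto_exp_neg_atTop_nhds_zero.comp (tendsto_id.const_mul_atTop (theta_pos β))
  have hlim : Tendsto (fun t : ℝ => (Fintype.card V * Real.exp (-(theta β * t))) ^ 2 +
      2 * Fintype.card V / theta β) atTop (𝓝 (2 * Fintype.card V / theta β)) := by
    have := ((hexp.const_mul (Fintype.card V : ℝ)).pow 2).add_const
      (2 * Fintype.card V / theta β)
    simpa using this
  exact ge_of_tendsto hlim (eventually_atTop.2 ⟨0, hbound⟩)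

end Ising

/-! ### Separating two measures by a statistic -/

section TotalVariation

variable {Ω : Type*} [Fintype Ω] {μ ν : Ω → ℝ}

theorem tvDist_le_one (hμ : ∀ ω, 0 ≤ μ ω) (hν : ∀ ω, 0 ≤ ν ω) (hμ1 : ∑ ω, μ ω = 1)
    (hν1 : ∑ ω, ν ω = 1) : tvDist μ ν ≤ 1 := by
  have h : ∑ ω, |μ ω - ν ω| ≤ ∑ ω, (μ ω + ν ω) :=
    Finset.sum_le_sum fun ω _ => abs_le.2 ⟨by linarith [hμ ω, hν ω], by linarith [hμ ω, hν ω]⟩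
  rw [Finset.sum_add_distrib, hμ1, hν1] at h
  unfold tvDist; linarith

/-- The second moment method: a statistic whose means differ by much more than its standard
deviations tells the two measures apart. -/
theorem one_sub_le_tvDist (hμ : ∀ ω, 0 ≤ μ ω) (hν : ∀ ω, 0 ≤ ν ω) (hμ1 : ∑ ω, μ ω = 1)
    (hν1 : ∑ ω, ν ω = 1) {f : Ω → ℝ} {m K : ℝ} (hm : 0 < m) (hmean : ∑ ω, μ ω * f ω = m)
    (hμ2 : ∑ ω, μ ω * f ω ^ 2 ≤ m ^ 2 + K) (hν2 : ∑ ω, ν ω * f ω ^ 2 ≤ K) :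
    1 - 8 * K / m ^ 2 ≤ tvDist μ ν := by
  -- Split at `f = m / 2`: on the wrong side a squared deviation is at least `m ^ 2 / 4`, and the
  -- factor `8 / m ^ 2` makes the penalty at least 2, so the coefficient there drops to at most -1.
  have hpt : ∀ ω, μ ω * (1 - 8 / m ^ 2 * (f ω - m) ^ 2) + ν ω * (1 - 8 / m ^ 2 * f ω ^ 2) ≤
      |μ ω - ν ω| := by
    intro ω
    have hm2 : 0 < m ^ 2 := by positivity
    have hA : 0 ≤ 8 / m ^ 2 * (f ω - m) ^ 2 := by positivity
    have hB : 0 ≤ 8 / m ^ 2 * f ω ^ 2 := by positivity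
    rcases le_total (f ω) (m / 2) with h | h
    · have h1 : 2 ≤ 8 / m ^ 2 * (f ω - m) ^ 2 := by
        rw [div_mul_eq_mul_div, le_div_iff₀ hm2]; nlinarith
      have := mul_le_mul_of_nonneg_left h1 (hμ ω)
      have := mul_nonneg (hν ω) hB
      have := neg_abs_le (μ ω - ν ω)
      linarith
    · have h1 : 2 ≤ 8 / m ^ 2 * f ω ^ 2 := by
        rw [div_mul_eq_mul_div, le_div_iff₀ hm2]; nlinarith
      have := mul_le_mul_of_nonneg_left h1 (hν ω)
      have := mul_nonneg (hμ ω) hA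
      have := le_abs_self (μ ω - ν ω)
      linarith
  have hsum := Finset.sum_le_sum fun ω (_ : ω ∈ Finset.univ) => hpt ω
  have hexpand : ∑ ω, (μ ω * (1 - 8 / m ^ 2 * (f ω - m) ^ 2) + ν ω * (1 - 8 / m ^ 2 * f ω ^ 2)) =
      (∑ ω, μ ω) + (∑ ω, ν ω) - 8 / m ^ 2 * ((∑ ω, μ ω * f ω ^ 2) - 2 * m * (∑ ω, μ ω * f ω) +
        m ^ 2 * (∑ ω, μ ω) + ∑ ω, ν ω * f ω ^ 2) := by
    simp only [Finset.mul_sum, ← Finset.sum_add_distrib, ← Finset.sum_sub_distrib]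
    exact Finset.sum_congr rfl fun ω _ => by ring
  rw [hexpand, hμ1, hν1, hmean] at hsum
  have hle : 8 / m ^ 2 * ((∑ ω, μ ω * f ω ^ 2) - 2 * m * m + m ^ 2 * 1 + ∑ ω, ν ω * f ω ^ 2) ≤
      8 / m ^ 2 * (2 * K) :=
    mul_le_mul_of_nonneg_left (by nlinarith) (by positivity)
  have heq : 8 / m ^ 2 * (2 * K) = 2 * (8 * K / m ^ 2) := by ring
  unfold tvDist
  linarith

end TotalVariation

section Glauber

variable {V : Type*} [Fintype V] [DecidableEq V] {G : SimpleGraph V} [DecidableRel G.Adj]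

/-- The dynamics is far from equilibrium as long as the total expected magnetization, measured in
absolute value site by site, is much larger than the square root of the number of sites. -/
theorem one_sub_le_tvDist_glauberLaw (hG : G.IsRegularOfDegree 2) {β : ℝ} (hβ : 0 ≤ β) {t : ℝ}
    (ht : 0 ≤ t) (x : V → ℤˣ) {m : ℝ} (hm : 0 < m)
    (hmean : m ≤ Real.exp (-(theta β * t)) *
      ∑ u, |∑ v, walkKernel G (1 - theta β) t u v * spin x v|) :
    1 - 16 * Fintype.card V / (theta β * m ^ 2) ≤
      tvDist (glauberLaw G β t x) (ising G β) := by
  have hθ := theta_pos β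
  have hL := glauberGenerator_isGenerator G β
  set R : V → ℝ := fun u => ∑ v, walkKernel G (1 - theta β) t u v * spin x v with hR
  -- The signs of `R` make the mean of the statistic a sum of absolute values.
  set w : V → ℝ := fun u => if 0 ≤ R u then 1 else -1 with hwdef
  have hw : ∀ u, |w u| ≤ 1 := by
    intro u
    rw [hwdef]
    dsimp only
    split_ifs <;> norm_num
  have hwR : ∀ u, w u * R u = |R u| := by
    intro u
    rw [hwdef]
    dsimp only
    split_ifs with h
    · rw [abs_of_nonneg h, one_mul]
    · rw [abs_of_neg (not_le.1 h)]; ring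
  have hmag : weightedMag (evolve G β t w) x = Real.exp (-(theta β * t)) * ∑ u, |R u| := by
    rw [← Finset.sum_congr rfl fun u _ => hwR u]
    simp only [weightedMag, evolve, hR, Finset.mul_sum, Finset.sum_mul]
    rw [Finset.sum_comm]
    refine Finset.sum_congr rfl fun u _ => Finset.sum_congr rfl fun v _ => ?_
    have : walkKernel G (1 - theta β) t u v = walkKernel G (1 - theta β) t v u :=
      exp_smul_symm (walkGenerator_symm hG _) t u v
    rw [this]; ring
  set M := Real.exp (-(theta β * t)) * ∑ u, |R u| with hM
  have hMpos : 0 < M := hm.trans_le hmean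
  have htv := one_sub_le_tvDist (μ := glauberLaw G β t x) (ν := ising G β) (f := weightedMag w)
    (fun τ => hL.exp_smul_nonneg ht x τ) (ising_nonneg G β) (hL.exp_smul_row_sum t x)
    (ising_sum G β) hMpos ((glauberLaw_weightedMag hG β t w x).trans hmag)
    (hmag ▸ glauberLaw_weightedMag_sq_le hG hβ ht hw x) (ising_weightedMag_sq_le hG hβ hw)
  refine le_trans ?_ htv
  have e : 8 * (2 * (Fintype.card V : ℝ) / theta β) / M ^ 2 =
      16 * Fintype.card V / (theta β * M ^ 2) := by field_simp; ring
  rw [e]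
  gcongr

end Glauber
end IsingCycle

namespace IsingCycle

/-! ### Return probability of the walk on the cycle -/

section Cycle

theorem cycleGraph_isRegularOfDegree (k : ℕ) :
    (SimpleGraph.cycleGraph (k + 3)).IsRegularOfDegree 2 :=
  fun _ => SimpleGraph.cycleGraph_degree_three_le

/-- The distance of `y` from `0` on the cycle. -/
def cycleNorm {k : ℕ} (y : Fin (k + 3)) : ℕ := min y.val (k + 3 - y.val)

theorem cycleNorm_add_one {k : ℕ} (y : Fin (k + 3)) :
    cycleNorm (y + 1) ≤ cycleNorm y + 1 ∧ cycleNorm y ≤ cycleNorm (y + 1) + 1 := by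
  have h := Fin.val_add_one y
  have hy := y.isLt
  unfold cycleNorm
  generalize (y + 1).val = z at h ⊢
  split_ifs at h with hl
  · have : y.val = k + 2 := by rw [hl]; rfl
    omega
  · have : y.val ≠ k + 2 := fun h' => hl (Fin.ext h')
    omega

theorem card_cycleNorm_sub_le {k : ℕ} (u : Fin (k + 3)) (K : ℕ) :
    (Finset.univ.filter fun v => cycleNorm (v - u) ≤ K).card ≤ 2 * K + 1 := by
  have hcard : (Finset.Icc (-(K : ℤ)) K).card = 2 * K + 1 := by
    rw [Int.card_Icc]; omega
  rw [← hcard]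
  refine Finset.card_le_card_of_injOn
    -- Points of the ball are sent to a representative of `v - u` modulo `k + 3` in `[-K, K]`.
    (fun v => if (v - u).val ≤ K then ((v - u).val : ℤ) else (v - u).val - (k + 3 : ℕ)) ?_ ?_
  · intro v hv
    replace hv := (Finset.mem_filter.1 (Finset.mem_coe.1 hv)).2
    unfold cycleNorm at hv
    have := (v - u).isLt
    simp only [Finset.coe_Icc, Set.mem_Icc]
    split_ifs <;> omega
  · intro v _ w _ hvw
    have h1 := (v - u).isLt
    have h2 := (w - u).isLt
    have h3 : (v - u).val = (w - u).val := by
      simp only at hvw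
      split_ifs at hvw <;> omega
    exact sub_left_injective (Fin.ext h3)

/-- Each of the two jumps has rate `r / 2` and increases the distance by at most 1. This ballistic
bound ignores cancellation, but costs only a power of `log n` at the times of interest. -/
theorem walkGenerator_cycleNorm_le {k : ℕ} {r : ℝ} (hr : 0 ≤ r) (u v : Fin (k + 3)) :
    ∑ w, walkGenerator (SimpleGraph.cycleGraph (k + 3)) r v w * (cycleNorm (w - u) : ℝ) ≤ r := by
  rw [walkGenerator_sum_mul]
  have hle : ∀ w ∈ (SimpleGraph.cycleGraph (k + 3)).neighborFinset v,
      r / ((SimpleGraph.cycleGraph (k + 3)).degree v : ℝ) *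
        ((cycleNorm (w - u) : ℝ) - cycleNorm (v - u)) ≤ r / 2 := by
    intro w hw
    rw [SimpleGraph.cycleGraph_neighborFinset (n := k + 1), Finset.mem_insert,
      Finset.mem_singleton] at hw
    have hstep : cycleNorm (w - u) ≤ cycleNorm (v - u) + 1 := by
      rcases hw with rfl | rfl
      · have := (cycleNorm_add_one (v - 1 - u)).2
        rwa [show v - 1 - u + 1 = v - u by abel] at this
      · have := (cycleNorm_add_one (v - u)).1
        rwa [show v - u + 1 = v + 1 - u by abel] at this
    have hstep' : (cycleNorm (w - u) : ℝ) ≤ cycleNorm (v - u) + 1 := by exact_mod_cast hstep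
    rw [(cycleGraph_isRegularOfDegree k).degree_eq]
    exact mul_le_of_le_one_right (by positivity) (by linarith)
  refine (Finset.sum_le_sum hle).trans ?_
  rw [Finset.sum_const, SimpleGraph.card_neighborFinset_eq_degree,
    (cycleGraph_isRegularOfDegree k).degree_eq, nsmul_eq_mul]
  push_cast
  linarith

/-- A lower bound for the return probability of the walk on the cycle. -/
theorem le_walkKernel_self {k : ℕ} {r : ℝ} (hr : 0 ≤ r) (hr1 : r ≤ 1) {t : ℝ} (ht : 0 ≤ t)
    (u : Fin (k + 3)) :
    1 / (4 * (2 * t + 1)) ≤ walkKernel (SimpleGraph.cycleGraph (k + 3)) r t u u := by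
  have hQ := walkGenerator_isGenerator (SimpleGraph.cycleGraph (k + 3)) hr
  have ht2 : 0 ≤ t / 2 := by linarith
  set p : Fin (k + 3) → ℝ :=
    fun v => walkKernel (SimpleGraph.cycleGraph (k + 3)) r (t / 2) u v with hp
  have hp0 : ∀ v, 0 ≤ p v := fun v => hQ.exp_smul_nonneg ht2 u v
  have hp1 : ∑ v, p v = 1 := hQ.exp_smul_row_sum (t / 2) u
  -- Chapman–Kolmogorov at half time, together with symmetry.
  have hself : walkKernel (SimpleGraph.cycleGraph (k + 3)) r t u u = ∑ v, p v ^ 2 := by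
    have h := exp_smul_add_apply (walkGenerator (SimpleGraph.cycleGraph (k + 3)) r) (t / 2) (t / 2)
      u u
    rw [add_halves] at h
    refine h.trans (Finset.sum_congr rfl fun v _ => ?_)
    rw [exp_smul_symm (walkGenerator_symm (cycleGraph_isRegularOfDegree k) r) (t / 2) v u, sq]
    rfl
  have hmean : ∑ v, p v * (cycleNorm (v - u) : ℝ) ≤ t / 2 := by
    have h := hQ.sum_exp_smul_mul_le (walkGenerator_cycleNorm_le hr u) ht2 u
    have h0 : (cycleNorm (u - u) : ℝ) = 0 := by simp [cycleNorm]
    rw [h0, zero_add] at h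
    exact h.trans (mul_le_of_le_one_left ht2 hr1)
  -- The mean distance at time `t / 2` is at most `t / 2`, and `K + 1 > t`, so by Markov's
  -- inequality the ball of radius `K` carries at least half the mass. Cauchy–Schwarz on this ball
  -- then bounds the sum of squares below.
  set K := ⌊t⌋₊
  have hK : t < K + 1 := Nat.lt_floor_add_one t
  have hKt : (K : ℝ) ≤ t := Nat.floor_le ht
  set B := Finset.univ.filter fun v : Fin (k + 3) => cycleNorm (v - u) ≤ K with hB
  have hfar : ∑ v ∈ Finset.univ.filter (fun v : Fin (k + 3) => ¬ cycleNorm (v - u) ≤ K), p v *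
      ((K : ℝ) + 1) ≤ t / 2 := by
    refine le_trans ?_ hmean
    refine (Finset.sum_le_sum fun v hv => ?_).trans (Finset.sum_le_sum_of_subset_of_nonneg
      (Finset.filter_subset _ _) fun v _ _ => mul_nonneg (hp0 v) (Nat.cast_nonneg _))
    refine mul_le_mul_of_nonneg_left ?_ (hp0 v)
    have := (Finset.mem_filter.1 hv).2
    exact_mod_cast (not_le.1 this)
  rw [← Finset.sum_mul] at hfar
  have hsplit := Finset.sum_filter_add_sum_filter_not Finset.univ
    (fun v : Fin (k + 3) => cycleNorm (v - u) ≤ K) p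
  rw [hp1, ← hB] at hsplit
  have hnear : 1 / 2 ≤ ∑ v ∈ B, p v := by nlinarith
  have hcs : (∑ v ∈ B, p v) ^ 2 ≤ B.card * ∑ v ∈ B, p v ^ 2 := sq_sum_le_card_mul_sum_sq
  have hcard : (B.card : ℝ) ≤ 2 * K + 1 := by exact_mod_cast card_cycleNorm_sub_le u K
  have hBle : ∑ v ∈ B, p v ^ 2 ≤ ∑ v, p v ^ 2 :=
    Finset.sum_le_sum_of_subset_of_nonneg (Finset.filter_subset _ _) fun v _ _ => sq_nonneg _
  have hB0 : 0 ≤ ∑ v ∈ B, p v ^ 2 := Finset.sum_nonneg fun v _ => sq_nonneg _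
  rw [hself, div_le_iff₀ (by positivity)]
  have h1 : (B.card : ℝ) * ∑ v ∈ B, p v ^ 2 ≤ (2 * t + 1) * ∑ v, p v ^ 2 :=
    mul_le_mul (by linarith) hBle hB0 (by linarith)
  nlinarith

end Cycle

/-! ### Quadratic forms in uniform signs, and Markov's inequality -/

section Uniform

variable {V : Type*} [Fintype V] [DecidableEq V]

theorem sum_eq_zero_of_flip_neg {g : (V → ℤˣ) → ℝ} {u : V} (hg : ∀ σ, g (flip σ u) = -g σ) :
    ∑ σ, g σ = 0 := by
  have h : ∑ σ, g (flip σ u) = ∑ σ, g σ := Equiv.sum_comp (flipEquiv u) g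
  simp only [hg, Finset.sum_neg_distrib] at h
  linarith

/-- If `a` or `b` is absent from the other pair, the product is odd under flipping that site;
otherwise the unordered pairs coincide. -/
theorem sum_spin_mul_four_le {a b c d : V} (hab : a ≠ b) (hcd : c ≠ d) :
    ∑ σ : V → ℤˣ, spin σ a * spin σ b * (spin σ c * spin σ d) ≤
      Fintype.card (V → ℤˣ) * ((if (c, d) = (a, b) then 1 else 0) +
        if (c, d) = (b, a) then 1 else 0) := by
  by_cases ha : a ≠ c ∧ a ≠ d
  · rw [sum_eq_zero_of_flip_neg (u := a)]
    · positivity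
    · intro σ
      rw [spin_flip_self, spin_flip_of_ne σ hab.symm, spin_flip_of_ne σ ha.1.symm,
        spin_flip_of_ne σ ha.2.symm]
      ring
  by_cases hb : b ≠ c ∧ b ≠ d
  · rw [sum_eq_zero_of_flip_neg (u := b)]
    · positivity
    · intro σ
      rw [spin_flip_self, spin_flip_of_ne σ hab, spin_flip_of_ne σ hb.1.symm,
        spin_flip_of_ne σ hb.2.symm]
      ring
  have hle : ∑ σ : V → ℤˣ, spin σ a * spin σ b * (spin σ c * spin σ d) ≤
      Fintype.card (V → ℤˣ) * 1 := by
    refine (Finset.sum_le_sum (g := fun _ => (1 : ℝ)) fun σ _ => ?_).trans (by simp)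
    refine (le_abs_self _).trans ?_
    simp [abs_mul, abs_spin]
  refine hle.trans (mul_le_mul_of_nonneg_left ?_ (Nat.cast_nonneg _))
  have hcase : (c, d) = (a, b) ∨ (c, d) = (b, a) := by
    rw [not_and_or, not_not, not_not] at ha hb
    rcases ha with rfl | rfl <;> rcases hb with rfl | rfl
    · exact absurd rfl hab
    · exact Or.inl rfl
    · exact Or.inr rfl
    · exact absurd rfl hab
  rcases hcase with h | h
  · rw [if_pos h]
    have : (0 : ℝ) ≤ if (c, d) = (b, a) then 1 else 0 := by split_ifs <;> norm_num
    linarith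
  · rw [if_pos h]
    have : (0 : ℝ) ≤ if (c, d) = (a, b) then 1 else 0 := by split_ifs <;> norm_num
    linarith

/-- The variance of a quadratic form with nonnegative symmetric coefficients in independent
uniform signs. -/
theorem sum_quadraticForm_sub_trace_sq_le {A : V → V → ℝ} (hA : ∀ u v, 0 ≤ A u v)
    (hsymm : ∀ u v, A u v = A v u) :
    ∑ σ : V → ℤˣ, ((∑ u, ∑ v, A u v * (spin σ u * spin σ v)) - ∑ u, A u u) ^ 2 ≤
      Fintype.card (V → ℤˣ) * (2 * ∑ u, ∑ v, A u v ^ 2) := by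
  -- Diagonal terms are deterministic, as squared spins are 1; removing them centres the form.
  set B : V × V → ℝ := fun p => if p.1 = p.2 then 0 else A p.1 p.2 with hB
  have hB0 : ∀ p, 0 ≤ B p := by
    intro p
    rw [hB]; dsimp only
    split_ifs
    exacts [le_rfl, hA _ _]
  have hBswap : ∀ p, B p.swap = B p := by
    intro p
    simp only [hB, Prod.fst_swap, Prod.snd_swap, eq_comm (a := p.2), hsymm p.2]
  have hcentre : ∀ σ : V → ℤˣ, (∑ u, ∑ v, A u v * (spin σ u * spin σ v)) - ∑ u, A u u =
      ∑ p : V × V, B p * (spin σ p.1 * spin σ p.2) := by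
    intro σ
    rw [Fintype.sum_prod_type, ← Finset.sum_sub_distrib]
    refine Finset.sum_congr rfl fun u _ => ?_
    have hdiag : A u u = ∑ v, if u = v then A u v * (spin σ u * spin σ v) else 0 := by
      simp [spin_mul_self]
    rw [hdiag, ← Finset.sum_sub_distrib]
    refine Finset.sum_congr rfl fun v _ => ?_
    simp only [hB]
    split_ifs <;> ring
  -- Since `B` is nonnegative, upper bounds on the four-spin sums suffice. Only `q = p` and `q =
  -- p.swap` contribute, hence the factor 2 in the variance.
  have hterm : ∀ p q : V × V, ∑ σ : V → ℤˣ,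
      B p * (spin σ p.1 * spin σ p.2) * (B q * (spin σ q.1 * spin σ q.2)) ≤
      Fintype.card (V → ℤˣ) * ((if q = p then B p * B q else 0) +
        if q = p.swap then B p * B q else 0) := by
    intro p q
    by_cases hp : p.1 = p.2
    · have : B p = 0 := by simp only [hB, if_pos hp]
      simp [this]
    by_cases hq : q.1 = q.2
    · have : B q = 0 := by simp only [hB, if_pos hq]
      simp [this]
    have h := mul_le_mul_of_nonneg_left (sum_spin_mul_four_le hp hq) (mul_nonneg (hB0 p) (hB0 q))
    rw [Finset.mul_sum] at h
    calc _ = ∑ σ : V → ℤˣ, B p * B q * (spin σ p.1 * spin σ p.2 * (spin σ q.1 * spin σ q.2)) :=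
          Finset.sum_congr rfl fun σ _ => by ring
      _ ≤ _ := h
      _ = _ := by
          change B p * B q * (Fintype.card (V → ℤˣ) * ((if q = p then 1 else 0) +
            if q = p.swap then 1 else 0)) = _
          split_ifs <;> ring
  calc _ = ∑ p : V × V, ∑ q : V × V, ∑ σ : V → ℤˣ,
        B p * (spin σ p.1 * spin σ p.2) * (B q * (spin σ q.1 * spin σ q.2)) := by
        simp only [hcentre, sq, Finset.sum_mul_sum]
        rw [Finset.sum_comm]
        exact Finset.sum_congr rfl fun p _ => Finset.sum_comm
    _ ≤ ∑ p : V × V, ∑ q : V × V, Fintype.card (V → ℤˣ) *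
          ((if q = p then B p * B q else 0) + if q = p.swap then B p * B q else 0) :=
        Finset.sum_le_sum fun p _ => Finset.sum_le_sum fun q _ => hterm p q
    _ = Fintype.card (V → ℤˣ) * (2 * ∑ p : V × V, B p ^ 2) := by
        simp only [← Finset.mul_sum, Finset.sum_add_distrib, Finset.sum_ite_eq', Finset.mem_univ,
          if_true, hBswap, sq]
        ring
    _ ≤ _ := by
        rw [← Fintype.sum_prod_type' fun u v => A u v ^ 2]
        refine mul_le_mul_of_nonneg_left (mul_le_mul_of_nonneg_left
          (Finset.sum_le_sum fun p _ => ?_) zero_le_two) (Nat.cast_nonneg _)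
        simp only [hB]
        split_ifs
        · rw [zero_pow two_ne_zero]; exact sq_nonneg _
        · exact le_rfl

end Uniform

section UniformProb

variable {Ω : Type*} [Fintype Ω]

theorem uniformProb_le_one (S : Set Ω) : uniformProb S ≤ 1 := by
  refine div_le_one_of_le₀ ?_ (Nat.cast_nonneg _)
  rw [← Nat.card_eq_fintype_card]
  exact_mod_cast Set.ncard_le_card S

/-- Markov's inequality for the uniform measure. -/
theorem one_sub_le_uniformProb [Nonempty Ω] {S : Set Ω} {g : Ω → ℝ} {c K : ℝ} (hc : 0 < c)
    (hg : ∀ ω, 0 ≤ g ω) (hS : ∀ ω, ω ∉ S → c ≤ g ω) (hK : ∑ ω, g ω ≤ Fintype.card Ω * K) :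
    1 - K / c ≤ uniformProb S := by
  classical
  have hcompl : (S.ncard : ℝ) + (Sᶜ.ncard : ℝ) = Fintype.card Ω := by
    rw [← Nat.card_eq_fintype_card]
    exact_mod_cast Set.ncard_add_ncard_compl S
  have hmarkov : (Sᶜ.ncard : ℝ) * c ≤ ∑ ω, g ω := by
    rw [Set.ncard_eq_toFinset_card', ← nsmul_eq_mul, ← Finset.sum_const]
    refine (Finset.sum_le_sum fun ω hω => hS ω (by simpa using hω)).trans
      (Finset.sum_le_sum_of_subset_of_nonneg (Finset.subset_univ _) fun ω _ _ => hg ω)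
  have hcard : (0 : ℝ) < Fintype.card Ω := by exact_mod_cast Fintype.card_pos
  rw [uniformProb, le_div_iff₀ hcard]
  have h1 : (Sᶜ.ncard : ℝ) ≤ Fintype.card Ω * K / c := by
    rw [le_div_iff₀ hc]; linarith
  have h2 : (1 - K / c) * (Fintype.card Ω : ℝ) = Fintype.card Ω - Fintype.card Ω * K / c := by ring
  linarith

end UniformProb
end IsingCycle

namespace IsingCycle

/-! ### Asymptotics at the test time -/

section TestTime

theorem theta_mul_testTime (n : ℕ) (β b : ℝ) :
    theta β * testTime n β b = Real.log n / 2 - Real.log (Real.log n) - Real.log b := by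
  have := (theta_pos β).ne'
  unfold testTime
  field_simp

theorem testTime_nonneg {n : ℕ} {β b : ℝ} (h1 : Real.log (Real.log n) ≤ Real.log n / 4)
    (h2 : Real.log b ≤ Real.log n / 4) : 0 ≤ testTime n β b := by
  refine nonneg_of_mul_nonneg_right ?_ (theta_pos β)
  rw [theta_mul_testTime]
  linarith

/-- This is what the test time is chosen for: the decay factor is `b log n / √n`, so a sum of at
least `n / b` leaves a mean of at least `√n log n`. -/
theorem exp_neg_theta_mul_testTime_sq {n : ℕ} {β b : ℝ} (hn : 0 < Real.log n) (hb : 0 < b) :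
    Real.exp (-(theta β * testTime n β b)) ^ 2 = (Real.log n * b) ^ 2 / n := by
  have hn0 : (0 : ℝ) < n := by
    rcases Nat.eq_zero_or_pos n with rfl | h
    · simp at hn
    · exact_mod_cast h
  rw [theta_mul_testTime, ← Real.exp_nat_mul]
  have e : ((2 : ℕ) : ℝ) * -(Real.log n / 2 - Real.log (Real.log n) - Real.log b) =
      (Real.log (Real.log n) + Real.log b) + (Real.log (Real.log n) + Real.log b) - Real.log n := by
    push_cast; ring
  rw [e, Real.exp_sub, Real.exp_add, Real.exp_add, Real.exp_log hn, Real.exp_log hb,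
    Real.exp_log hn0, sq]

theorem tendsto_log_natCast : Tendsto (fun n : ℕ => Real.log n) atTop atTop :=
  Real.tendsto_log_atTop.comp tendsto_natCast_atTop_atTop

/-- With `c = log C` this controls `log b` for `b = C log n`; with `c = 0`, the iterated logarithm
in the test time. -/
theorem eventually_log_log_add_le (c : ℝ) :
    ∀ᶠ n : ℕ in atTop, c + Real.log (Real.log n) ≤ Real.log n / 4 := by
  have h1 : ∀ᶠ y : ℝ in atTop, ‖Real.log y‖ ≤ 1 / 8 * ‖id y‖ :=
    Real.isLittleO_log_id_atTop.bound (by norm_num)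
  filter_upwards [tendsto_log_natCast.eventually h1,
    tendsto_log_natCast.eventually_ge_atTop (8 * |c|)] with n hn hc
  have h0 : 0 ≤ Real.log n := (by positivity : 0 ≤ 8 * |c|).trans hc
  rw [Real.norm_eq_abs, Real.norm_eq_abs, id, abs_of_nonneg h0] at hn
  have := le_abs_self (Real.log (Real.log n))
  have := le_abs_self c
  linarith

end TestTime

theorem tendsto_tvDist_glauberLaw {β : ℝ} (hβ : 0 ≤ β) {a : ℕ → ℝ} {x₀ : (n : ℕ) → Fin n → ℤˣ}
    (ha : IsSubpolynomial a) (hx : ∀ᶠ n : ℕ in atTop, MagCondition n β (a n) (x₀ n)) :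
    Tendsto (fun n : ℕ => tvDist
      (glauberLaw (SimpleGraph.cycleGraph n) β (testTime n β (a n)) (x₀ n))
      (ising (SimpleGraph.cycleGraph n) β)) atTop (𝓝 1) := by
  have hθ := theta_pos β
  obtain ⟨e, he, hae⟩ := ha
  have htime : ∀ᶠ n : ℕ in atTop, 0 < Real.log n ∧ 0 < a n ∧ 0 ≤ testTime n β (a n) := by
    filter_upwards [hae, he.eventually_le_const (show (0 : ℝ) < 1 / 4 by norm_num),
      eventually_log_log_add_le 0, tendsto_log_natCast.eventually_gt_atTop 0, eventually_gt_atTop 0]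
      with n h1 h2 h3 h4 h5
    have hn : (0 : ℝ) < n := by exact_mod_cast h5
    refine ⟨h4, h1 ▸ Real.rpow_pos_of_pos hn _, testTime_nonneg (by linarith) ?_⟩
    rw [h1, Real.log_rpow hn]
    nlinarith
  have hlower : ∀ᶠ n : ℕ in atTop, 1 - 16 / theta β * (Real.log n ^ 2)⁻¹ ≤ tvDist
      (glauberLaw (SimpleGraph.cycleGraph n) β (testTime n β (a n)) (x₀ n))
      (ising (SimpleGraph.cycleGraph n) β) := by
    filter_upwards [htime, hx, eventually_ge_atTop 3] with n ⟨hlog, han, ht⟩ hmag hn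
    obtain ⟨k, rfl⟩ := Nat.exists_eq_add_of_le' hn
    set n := k + 3 with hndef
    have hn0 : (0 : ℝ) < n := by rw [hndef]; positivity
    set E := Real.exp (-(theta β * testTime n β (a n))) with hE
    have hEpos : 0 < E := Real.exp_pos _
    have hsum : n / a n ≤ ∑ u, |signedMag n β (testTime n β (a n)) u (x₀ n)| := by
      unfold MagCondition at hmag
      rw [one_div_mul_eq_div, le_div_iff₀ hn0, one_div_mul_eq_div] at hmag
      exact hmag
    have hsq : (E * (n / a n)) ^ 2 = n * Real.log n ^ 2 := by
      rw [mul_pow, hE, exp_neg_theta_mul_testTime_sq hlog han]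
      field_simp
    have h := one_sub_le_tvDist_glauberLaw (cycleGraph_isRegularOfDegree k) hβ ht (x₀ n)
      (m := E * (n / a n)) (by positivity) (mul_le_mul_of_nonneg_left hsum hEpos.le)
    rw [hsq, Fintype.card_fin] at h
    refine le_trans (le_of_eq ?_) h
    rw [← hndef]
    field_simp
  have hupper : ∀ᶠ n : ℕ in atTop, tvDist
      (glauberLaw (SimpleGraph.cycleGraph n) β (testTime n β (a n)) (x₀ n))
      (ising (SimpleGraph.cycleGraph n) β) ≤ 1 := by
    filter_upwards [htime] with n ⟨_, _, ht⟩
    have hL := glauberGenerator_isGenerator (SimpleGraph.cycleGraph n) β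
    exact tvDist_le_one (fun τ => hL.exp_smul_nonneg ht _ τ) (ising_nonneg _ β)
      (hL.exp_smul_row_sum _ _) (ising_sum _ β)
  have hlim : Tendsto (fun n : ℕ => 1 - 16 / theta β * (Real.log n ^ 2)⁻¹) atTop (𝓝 1) := by
    have := (((tendsto_pow_atTop two_ne_zero).comp tendsto_log_natCast).inv_tendsto_atTop.const_mul
      (16 / theta β)).const_sub 1
    simpa using this
  exact tendsto_of_tendsto_of_tendsto_of_le_of_le' hlim tendsto_const_nhds hlower hupper

/-- At a time at most logarithmic in the length of the cycle, the absolute magnetizations of a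
uniform starting state add up to a large value with high probability. -/
theorem one_sub_le_uniformProb_signedMag {k : ℕ} {β t c : ℝ} (hβ : 0 ≤ β) (ht : 0 ≤ t)
    (hc : 0 < c) (hct : c * (8 * (2 * t + 1)) ≤ 1) :
    1 - 2 / ((k + 3 : ℕ) * c ^ 2) ≤ uniformProb {x₀ : Fin (k + 3) → ℤˣ |
      c ≤ 1 / ((k + 3 : ℕ) : ℝ) * ∑ u, |signedMag (k + 3) β t u x₀|} := by
  set n := k + 3 with hndef
  have hn0 : (0 : ℝ) < n := by rw [hndef]; positivity
  have hθ := theta_pos β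
  have hθ1 := theta_le_one hβ
  have hr : 0 ≤ 1 - theta β := sub_nonneg.2 hθ1
  have hQ := walkGenerator_isGenerator (SimpleGraph.cycleGraph n) hr
  set P : Fin n → Fin n → ℝ :=
    fun u v => walkKernel (SimpleGraph.cycleGraph n) (1 - theta β) t u v with hP
  have hP0 : ∀ u v, 0 ≤ P u v := fun u v => hQ.exp_smul_nonneg ht u v
  have hP1 : ∀ u, ∑ v, P u v = 1 := fun u => hQ.exp_smul_row_sum t u
  have hPle : ∀ u v, P u v ≤ 1 := fun u v =>
    (Finset.single_le_sum (fun w _ => hP0 u w) (Finset.mem_univ v)).trans_eq (hP1 u)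
  have hPsymm : ∀ u v, P u v = P v u := fun u v =>
    exp_smul_symm (walkGenerator_symm (cycleGraph_isRegularOfDegree k) _) t u v
  -- The mean is twice the target `n * c`, so failure forces a deviation of at least `n * c`.
  have htrace : n * (2 * c) ≤ ∑ u, P u u := by
    have h : ∀ u : Fin n, 2 * c ≤ P u u := by
      intro u
      refine le_trans ?_ (le_walkKernel_self hr (by linarith) ht u)
      rw [le_div_iff₀ (by positivity)]
      linarith
    have := Finset.sum_le_sum fun u (_ : u ∈ Finset.univ) => h u
    rwa [Finset.sum_const, Finset.card_univ, Fintype.card_fin, nsmul_eq_mul] at this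
  have hvar : 2 * ∑ u, ∑ v, P u v ^ 2 ≤ 2 * n := by
    refine mul_le_mul_of_nonneg_left ?_ zero_le_two
    have h : ∀ u, ∑ v, P u v ^ 2 ≤ 1 := fun u => by
      rw [← hP1 u]
      exact Finset.sum_le_sum fun v _ => pow_le_of_le_one (hP0 u v) (hPle u v) two_ne_zero
    refine (Finset.sum_le_sum fun u _ => h u).trans ?_
    simp
  -- The starting spins themselves serve as the signs, which bounds the absolute values below by a
  -- quadratic form.
  have hquad : ∀ x : Fin n → ℤˣ, ∑ u, ∑ v, P u v * (spin x u * spin x v) ≤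
      ∑ u, |signedMag n β t u x| := by
    intro x
    refine Finset.sum_le_sum fun u _ => ?_
    calc ∑ v, P u v * (spin x u * spin x v) = spin x u * signedMag n β t u x := by
          rw [signedMag, Finset.mul_sum]
          exact Finset.sum_congr rfl fun v _ => by rw [hP]; ring
      _ ≤ |spin x u * signedMag n β t u x| := le_abs_self _
      _ = _ := by rw [abs_mul, abs_spin, one_mul]
  have hmarkov := one_sub_le_uniformProb (Ω := Fin n → ℤˣ)
    (S := {x₀ | c ≤ 1 / (n : ℝ) * ∑ u, |signedMag n β t u x₀|})
    (g := fun x => ((∑ u, ∑ v, P u v * (spin x u * spin x v)) - ∑ u, P u u) ^ 2)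
    (c := (n * c) ^ 2) (K := 2 * n) (by positivity) (fun _ => sq_nonneg _) ?_
    ((sum_quadraticForm_sub_trace_sq_le hP0 hPsymm).trans
      (mul_le_mul_of_nonneg_left hvar (Nat.cast_nonneg _)))
  · refine le_trans (le_of_eq ?_) hmarkov
    field_simp
  · intro x hx
    have hx' : 1 / (n : ℝ) * ∑ u, |signedMag n β t u x| < c := not_le.1 hx
    rw [one_div_mul_eq_div, div_lt_iff₀ hn0] at hx'
    have h1 := hquad x
    have h2 : n * c ≤ (∑ u, P u u) - ∑ u, ∑ v, P u v * (spin x u * spin x v) := by linarith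
    calc (n * c) ^ 2 ≤ ((∑ u, P u u) - ∑ u, ∑ v, P u v * (spin x u * spin x v)) ^ 2 :=
          pow_le_pow_left₀ (by positivity) h2 2
      _ = _ := by ring

theorem tendsto_uniformProb_magCondition {β : ℝ} (hβ : 0 ≤ β) :
    Tendsto (fun n : ℕ => uniformProb
      {x₀ : Fin n → ℤˣ | MagCondition n β (16 / theta β * Real.log n) x₀}) atTop (𝓝 1) := by
  have hθ := theta_pos β
  have hθ1 := theta_le_one hβ
  have hC : 16 ≤ 16 / theta β := by rw [le_div_iff₀ hθ]; linarith
  have hlower : ∀ᶠ n : ℕ in atTop, 1 - 2 * (16 / theta β) ^ 2 * (Real.log n ^ 2 / n) ≤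
      uniformProb {x₀ : Fin n → ℤˣ | MagCondition n β (16 / theta β * Real.log n) x₀} := by
    filter_upwards [eventually_log_log_add_le 0, eventually_log_log_add_le (Real.log (16 / theta β)),
      tendsto_log_natCast.eventually_ge_atTop 1, eventually_ge_atTop 3] with n h1 h2 hlog hn
    obtain ⟨k, rfl⟩ := Nat.exists_eq_add_of_le' hn
    set n := k + 3 with hndef
    have hlogb : Real.log (16 / theta β * Real.log n) =
        Real.log (16 / theta β) + Real.log (Real.log n) :=
      Real.log_mul (by positivity) (by positivity)
    have ht : 0 ≤ testTime n β (16 / theta β * Real.log n) :=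
      testTime_nonneg (by linarith) (by rw [hlogb]; exact h2)
    have htle : theta β * testTime n β (16 / theta β * Real.log n) ≤ Real.log n / 2 := by
      rw [theta_mul_testTime, hlogb]
      have := Real.log_nonneg hlog
      have := Real.log_nonneg (show 1 ≤ 16 / theta β by linarith)
      linarith
    -- Origin of the constant 16: `2t ≤ log n / θ` and `1 ≤ log n / θ`, so `8 (2t + 1) ≤ 16 log n /
    -- θ`.
    have hct : 1 / (16 / theta β * Real.log n) *
        (8 * (2 * testTime n β (16 / theta β * Real.log n) + 1)) ≤ 1 := by
      generalize testTime n β (16 / theta β * Real.log n) = t at htle ⊢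
      rw [one_div_mul_eq_div, div_le_one (by positivity), div_mul_eq_mul_div, le_div_iff₀ hθ]
      linarith
    have h := one_sub_le_uniformProb_signedMag (k := k) hβ ht (by positivity) hct
    refine le_trans (le_of_eq ?_) h
    have : (0 : ℝ) < n := by rw [hndef]; positivity
    rw [← hndef]
    field_simp
  have hlim : Tendsto (fun n : ℕ => 1 - 2 * (16 / theta β) ^ 2 * (Real.log n ^ 2 / n)) atTop
      (𝓝 1) := by
    have h := (Real.isLittleO_pow_log_id_atTop (n := 2)).tendsto_div_nhds_zero.comp
      (tendsto_natCast_atTop_atTop (R := ℝ))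
    have := (h.const_mul (2 * (16 / theta β) ^ 2)).const_sub 1
    simpa using this
  exact tendsto_of_tendsto_of_tendsto_of_le_of_le' hlim tendsto_const_nhds hlower
    (Eventually.of_forall fun n => uniformProb_le_one _)

end IsingCycle

theorem proposition6p1 (β : ℝ) (hβ : 0 ≤ β) :
    (∀ (a : ℕ → ℝ) (x₀ : (n : ℕ) → Fin n → ℤˣ), IsingCycle.IsSubpolynomial a →
      (∀ᶠ n : ℕ in atTop, IsingCycle.MagCondition n β (a n) (x₀ n)) →
      Tendsto (fun n : ℕ => IsingCycle.tvDist
          (IsingCycle.glauberLaw (SimpleGraph.cycleGraph n) β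
            (IsingCycle.testTime n β (a n)) (x₀ n))
          (IsingCycle.ising (SimpleGraph.cycleGraph n) β))
        atTop (𝓝 1)) ∧
    ∃ C : ℝ, 0 < C ∧
      Tendsto (fun n : ℕ => IsingCycle.uniformProb
          {x₀ : Fin n → ℤˣ | IsingCycle.MagCondition n β (C * Real.log n) x₀})
        atTop (𝓝 1) :=
  ⟨fun _ _ ha hx => IsingCycle.tendsto_tvDist_glauberLaw hβ ha hx,
    16 / IsingCycle.theta β, div_pos (by norm_num) (IsingCycle.theta_pos β),
    IsingCycle.tendsto_uniformProb_magCondition hβ⟩
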